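/- Let $(\Omega,\mathcal F,\mathbb P)$ be a probability space, $X$ a $d$-dimensional random vector with distribution $\nu_X$ and $Y$ a square-integrable real random variable on it, and let $\bar f:\mathbb R^d\to\mathbb R$ be a Borel function with $\bar f(X)=\mathbb E[Y\mid X]$ $\mathbb P$-almost surely. Let $\mathbb P[\,\cdot\mid X=x]$ be a regular conditional version of $\mathbb P$ given $X$, let $\nu\ll\nu_X$ be a Borel probability measure on $\mathbb R^d$, and set $\mathbb P^\nu[A]:=\int_{\mathbb R^d}\mathbb P[A\mid X=x]\,d\nu(x)$, with expectation $\mathbb E^\nu$. Suppose that, $\mathbb P^\nu$-almost surely, $Y=h(X,V)$ for a Borel function $h:\mathbb R^{d}\times\mathbb R^k\to\mathbb R$ and a $k$-dimensional random vector $V$ that is independent of $X$ under $\mathbb P^\nu$. Let $\hat f:\mathbb R^d\to\mathbb R$ be Borel. On some probability space $(\Omega',\mathbb P')$ (for example $(\Omega,\mathbb P^\nu)$, if it is rich enough), let $(X^n,Y^n,\tilde V^n)$, $n\ge 1$, be independent triples such that $(X^n,Y^n)$ has the $\mathbb P^\nu$-distribution of $(X,Y)$, and $\tilde V^n$ has the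 $\mathbb P^\nu$-distribution of $V$ and is independent of $(X^n,Y^n)$. Put $Z^n:=h(X^n,\tilde V^n)$, $W^n:=Y^nZ^n+\hat f(X^n)\big(\hat f(X^n)-Y^n-Z^n\big)$, and $$F^\nu:=\|\hat f-\bar f\|_{L^2(\nu)}^2,\qquad F^\nu_N:=\frac1N\sum_{n=1}^N W^n,\qquad v^{F,\nu}_N:=\frac1{N-1}\sum_{n=1}^N\big(W^n-F^\nu_N\big)^2 .$$ For $\alpha\in(0,1)$ let $q_\alpha$ be the $\alpha$-quantile of the standard normal distribution. If $\mathbb E^\nu Y^4<\infty$ and $\mathbb E^\nu \hat f(X)^4<\infty$, then $\hat f-\bar f\in L^2(\nu)$ (so that $F^\nu$ is finite) and, for every $\alpha\in(0,1)$, $$\liminf_{N\to\infty}\ \mathbb P'\!\left[F^\nu\le F^\nu_N+q_\alpha\sqrt{\frac{v^{F,\nu}_N}{N}}\,\right]\ \ge\ \alpha .$$ -/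

import Mathlib

open MeasureTheory ProbabilityTheory Filter

noncomputable section

namespace RegressionError

/-- `κ` is a regular conditional version of `P` given `X`, i.e. `κ x A = P[A | X = x]`:
a Markov kernel such that `P[X ∈ B, A] = ∫_B κ x A dν_X(x)` for all measurable `A`, `B`,
where `ν_X = P.map X` is the distribution of `X`. -/
structure IsRegularCondVersion {Ω E : Type*} [MeasurableSpace Ω] [MeasurableSpace E]
    (κ : Kernel E Ω) (P : Measure Ω) (X : Ω → E) : Prop where
  isMarkovKernel : IsMarkovKernel κ
  disintegration : ∀ A : Set Ω, MeasurableSet A → ∀ B : Set E, MeasurableSet B →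
    P (X ⁻¹' B ∩ A) = ∫⁻ x in B, κ x A ∂(P.map X)

/-- The distorted measure `P^ν[A] = ∫ P[A | X = x] dν(x)`, where `κ x = P[· | X = x]`. -/
def distortedMeasure {Ω E : Type*} [MeasurableSpace Ω] [MeasurableSpace E]
    (κ : Kernel E Ω) (ν : Measure E) : Measure Ω :=
  ν.bind κ

theorem distortedMeasure_apply {Ω E : Type*} [MeasurableSpace Ω] [MeasurableSpace E]
    (κ : Kernel E Ω) (ν : Measure E) {A : Set Ω} (hA : MeasurableSet A) :
    distortedMeasure κ ν A = ∫⁻ x, κ x A ∂ν :=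
  Measure.bind_apply hA κ.measurable.aemeasurable

/-- `f` is a regression function of `Y` on `X` under `P`: it is Borel and `f(X)` is a version of
the conditional expectation `E[Y | X]`. -/
def IsRegressionFunction {Ω E : Type*} [MeasurableSpace Ω] [mE : MeasurableSpace E]
    (f : E → ℝ) (P : Measure Ω) (X : Ω → E) (Y : Ω → ℝ) : Prop :=
  Measurable f ∧ (fun ω => f (X ω)) =ᵐ[P] P[Y | mE.comap X]

/-- The `α`-quantile of the standard normal distribution. -/
def normalQuantile (α : ℝ) : ℝ :=
  sInf {x : ℝ | α ≤ cdf (gaussianReal 0 1) x}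

/-- The squared `L²(ν)`-error `‖f - g‖²_{L²(ν)}`. -/
def sqL2Error {E : Type*} [MeasurableSpace E] (ν : Measure E) (f g : E → ℝ) : ℝ :=
  ∫ x, (f x - g x) ^ 2 ∂ν

/-- On the probability space `(Ω', P')`, the triples `(X n, Y n, V' n)`, `n = 0, 1, 2, …`, are
independent, `(X n, Y n)` has the joint law `μXY`, and `V' n` has the law `μV` and is independent
of `(X n, Y n)`. -/
structure IsMonteCarloSample {Ω' E G : Type*} [MeasurableSpace Ω'] [MeasurableSpace E]
    [MeasurableSpace G] (P' : Measure Ω') (μXY : Measure (E × ℝ)) (μV : Measure G)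
    (X : ℕ → Ω' → E) (Y : ℕ → Ω' → ℝ) (V' : ℕ → Ω' → G) : Prop where
  measurable_X : ∀ n, Measurable (X n)
  measurable_Y : ∀ n, Measurable (Y n)
  measurable_V' : ∀ n, Measurable (V' n)
  indep : iIndepFun (fun n ω => (X n ω, Y n ω, V' n ω)) P'
  law_XY : ∀ n, P'.map (fun ω => (X n ω, Y n ω)) = μXY
  law_V' : ∀ n, P'.map (V' n) = μV
  indep_V' : ∀ n, IndepFun (fun ω => (X n ω, Y n ω)) (V' n) P'

/-- The summand `y z + f(x) (f(x) - y - z)` with `z = h(x, v')`. -/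
def errorTerm {E G : Type*} (f : E → ℝ) (h : E × G → ℝ) (x : E) (y : ℝ) (v' : G) : ℝ :=
  y * h (x, v') + f x * (f x - y - h (x, v'))

/-- The average `N⁻¹ ∑ w n` of the first `N` values. -/
def sampleMean (w : ℕ → ℝ) (N : ℕ) : ℝ :=
  (∑ n ∈ Finset.range N, w n) / N

/-- The sample variance `(N - 1)⁻¹ ∑ (w n - mean)²` of the first `N` values. -/
def sampleVar (w : ℕ → ℝ) (N : ℕ) : ℝ :=
  (∑ n ∈ Finset.range N, (w n - sampleMean w N) ^ 2) / ((N : ℝ) - 1)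

end RegressionError

end

open scoped Topology

namespace RegressionError

/-! ### Asymptotic confidence bound for the mean of an i.i.d. sequence -/

section ConfidenceBound

/-! The error term factors as `(Y - f̂(X)) (Z - f̂(X))`. Since `Z` uses a fresh copy of `V`, both
factors have conditional mean `(f̄ - f̂)(X)` given `X`, so the product is an unbiased estimator of
the squared error; fourth moments make it square integrable (`errorTerm_memLp_and_integral`).

The bound is then the usual one for an i.i.d. mean: central limit theorem, strong law for the sample
variance, Slutsky and portmanteau (`le_liminf_measure_mean_le`).

That `f̄`, defined under `P`, is still the regression function under `P^ν` holds because `P^ν` has a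
density with respect to `P` that depends on `X` only (`IsRegressionFunction.distortedMeasure`). -/

theorem le_cdf_normalQuantile {α : ℝ} (hα : α ∈ Set.Ioo (0 : ℝ) 1) :
    α ≤ cdf (gaussianReal 0 1) (normalQuantile α) := by
  obtain ⟨x₁, hx₁⟩ :=
    ((tendsto_cdf_atTop (gaussianReal 0 1)).eventually (lt_mem_nhds hα.2)).exists
  obtain ⟨x₀, hx₀⟩ :=
    ((tendsto_cdf_atBot (gaussianReal 0 1)).eventually (gt_mem_nhds hα.1)).exists
  have hne : {x : ℝ | α ≤ cdf (gaussianReal 0 1) x}.Nonempty := ⟨x₁, hx₁.le⟩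
  by_contra! hlt
  -- Right continuity would keep the cdf below `α` slightly to the right of the infimum, where
  -- monotonicity forces it to be at least `α`.
  have hcont := (cdf (gaussianReal 0 1)).right_continuous (normalQuantile α)
  have hev : ∀ᶠ y in 𝓝[>] (normalQuantile α), cdf (gaussianReal 0 1) y < α :=
    (hcont.mono Set.Ioi_subset_Ici_self).eventually (gt_mem_nhds hlt)
  obtain ⟨y, hy, hqy⟩ := (hev.and self_mem_nhdsWithin).exists
  obtain ⟨s, hs, hsy⟩ := exists_lt_of_csInf_lt hne (show sInf _ < y from hqy)
  exact absurd ((hs.trans (monotone_cdf _ hsy.le)).trans_lt hy) (lt_irrefl _)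

/-- In this form the limit follows from the strong law for `w` and for `w ^ 2`. -/
theorem sampleVar_eq (w : ℕ → ℝ) {N : ℕ} (hN : 2 ≤ N) :
    sampleVar w N =
      (sampleMean (fun n => w n ^ 2) N - sampleMean w N ^ 2) * ((N : ℝ) / ((N : ℝ) - 1)) := by
  have hN' : (2 : ℝ) ≤ N := by exact_mod_cast hN
  have h0 : (N : ℝ) ≠ 0 := by linarith
  have h1 : (N : ℝ) - 1 ≠ 0 := by linarith
  have hs : ∑ n ∈ Finset.range N, w n = N * sampleMean w N := by
    unfold sampleMean; field_simp
  have hs2 : ∑ n ∈ Finset.range N, w n ^ 2 = N * sampleMean (fun n => w n ^ 2) N := by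
    unfold sampleMean; field_simp
  have key : ∑ n ∈ Finset.range N, (w n - sampleMean w N) ^ 2 =
      N * sampleMean (fun n => w n ^ 2) N - N * sampleMean w N ^ 2 := by
    simp_rw [sub_sq, Finset.sum_add_distrib, Finset.sum_sub_distrib, ← Finset.sum_mul,
      ← Finset.mul_sum, hs, hs2]
    simp
    ring
  rw [sampleVar, key]
  field_simp

theorem tendsto_sampleVar {w : ℕ → ℝ} {a b : ℝ} (h1 : Tendsto (sampleMean w) atTop (𝓝 a))
    (h2 : Tendsto (sampleMean fun n => w n ^ 2) atTop (𝓝 b)) :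
    Tendsto (sampleVar w) atTop (𝓝 (b - a ^ 2)) := by
  have hq : Tendsto (fun N : ℕ => (N : ℝ) / ((N : ℝ) - 1)) atTop (𝓝 1) := by
    simpa [sub_eq_add_neg] using tendsto_natCast_div_add_atTop (-1 : ℝ)
  have := (h2.sub (h1.pow 2)).mul hq
  rw [mul_one] at this
  refine this.congr' ?_
  filter_upwards [eventually_ge_atTop 2] with N hN
  exact (sampleVar_eq w hN).symm

variable {Ω : Type*} [MeasurableSpace Ω] {P : Measure Ω} [IsProbabilityMeasure P]
  {W : ℕ → Ω → ℝ}

theorem ae_tendsto_sampleVar (hW : MemLp (W 0) 2 P) (hindep : iIndepFun W P)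
    (hident : ∀ n, IdentDistrib (W n) (W 0) P P) :
    ∀ᵐ ω ∂P, Tendsto (sampleVar fun n => W n ω) atTop (𝓝 Var[W 0; P]) := by
  have h1 := strong_law_ae_real W (hW.integrable one_le_two)
    (fun i j hij => hindep.indepFun hij) hident
  have h2 := strong_law_ae_real (fun n ω => W n ω ^ 2) hW.integrable_sq
    (fun i j hij => (hindep.indepFun hij).comp (measurable_id.pow_const 2)
      (measurable_id.pow_const 2))
    (fun n => (hident n).comp (measurable_id.pow_const 2))
  filter_upwards [h1, h2] with ω hω1 hω2
  rw [variance_eq_sub hW]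
  exact tendsto_sampleVar hω1 hω2

/-- The random variable `σ Z + σ q` with `Z` standard normal is positive with
probability `Φ(q)`. -/
theorem gaussianReal_add_mul_pos {v : NNReal} (hv : v ≠ 0) (q : ℝ) :
    gaussianReal 0 v {x | 0 < x + q * √v} = gaussianReal 0 1 (Set.Iic q) := by
  have hs : 0 < √(v : ℝ) := Real.sqrt_pos.2 (by positivity)
  -- By symmetry the scaling may be negative, which turns the event directly into `x < q`.
  have hmap : gaussianReal 0 v = (gaussianReal 0 1).map (fun x => -√(v : ℝ) * x) := by
    rw [gaussianReal_map_const_mul]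
    congr 1
    · simp
    · ext; simp
  have := nullSingletonClass_gaussianReal (μ := 0) (v := 1) one_ne_zero
  rw [hmap, Measure.map_apply (by fun_prop) (measurableSet_lt (by fun_prop) (by fun_prop)),
    ← measure_congr Iio_ae_eq_Iic]
  congr 1
  ext x
  simp only [Set.mem_preimage, Set.mem_ofPred_eq, Set.mem_Iio]
  constructor <;> intro h <;> nlinarith

/-- Asymptotic one-sided confidence bound for the mean of an i.i.d. sequence. -/
theorem le_liminf_measure_mean_le (hW : MemLp (W 0) 2 P) (hindep : iIndepFun W P)
    (hident : ∀ n, IdentDistrib (W n) (W 0) P P) {α : ℝ} (hα : α ∈ Set.Ioo (0 : ℝ) 1) :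
    ENNReal.ofReal α ≤ liminf (fun N : ℕ => P {ω | P[W 0] ≤ sampleMean (fun n => W n ω) N +
      normalQuantile α * √(sampleVar (fun n => W n ω) N / (N : ℝ))}) atTop := by
  -- With zero variance the limit law is a point mass at `0`, outside the open set `(0, ∞)`, and
  -- portmanteau gives nothing; but then the bound holds with equality almost surely.
  obtain hv | hv := eq_or_ne Var[W 0; P] 0
  · have hconst : ∀ᵐ ω ∂P, ∀ n, W n ω = P[W 0] := by
      refine ae_all_iff.2 fun n => ?_
      have := ae_eq_integral_of_variance_eq_zero ((hident n).memLp_iff.2 hW)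
        ((hident n).variance_eq.trans hv)
      rwa [(hident n).integral_eq] at this
    refine (ENNReal.ofReal_le_one.2 hα.2.le).trans (le_liminf_of_le (by isBoundedDefault) ?_)
    filter_upwards [eventually_ge_atTop 1] with N hN
    have hN' : (N : ℝ) ≠ 0 := by positivity
    refine measure_univ.ge.trans (measure_mono_ae (hconst.mono fun ω hω _ => ?_))
    have hmean : sampleMean (fun n => W n ω) N = P[W 0] := by
      simp only [sampleMean, hω, Finset.sum_const, Finset.card_range, nsmul_eq_mul]
      field_simp
    have hvar : sampleVar (fun n => W n ω) N = 0 := by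
      rw [sampleVar, hmean]
      simp [hω]
    change P[W 0] ≤ _
    simp [hmean, hvar]
  · set q := normalQuantile α
    set σ2 : NNReal := Var[W 0; P].toNNReal with hσ2
    have hσ2' : (σ2 : ℝ) = Var[W 0; P] := Real.coe_toNNReal _ (variance_nonneg _ _)
    have hσ0 : σ2 ≠ 0 := by
      intro h; rw [h] at hσ2'; exact hv hσ2'.symm
    have hmW n : AEMeasurable (W n) P := (hident n).aemeasurable_fst
    have hmV N : AEMeasurable (fun ω => sampleVar (fun n => W n ω) N) P := by
      unfold sampleVar sampleMean; fun_prop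
    have hclt := tendstoInDistribution_inv_sqrt_mul_sum_sub (P' := gaussianReal 0 σ2)
      (Y := id) ⟨aemeasurable_id, Measure.map_id⟩ hW hindep hident
    have hmY N : AEMeasurable (fun ω => q * √(sampleVar (fun n => W n ω) N)) P := by
      have := hmV N; fun_prop
    have hvar : TendstoInMeasure P (fun N ω => q * √(sampleVar (fun n => W n ω) N)) atTop
        (fun _ => q * √(σ2 : ℝ)) := by
      refine tendstoInMeasure_of_tendsto_ae (fun N => (hmY N).aestronglyMeasurable) ?_
      filter_upwards [ae_tendsto_sampleVar hW hindep hident] with ω hω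
      rw [hσ2']
      exact hω.sqrt.const_mul q
    have hsum := hclt.add_of_tendstoInMeasure_const hvar hmY
    have hopen := ProbabilityMeasure.le_liminf_measure_open_of_tendsto hsum.tendsto
      (G := Set.Ioi (0 : ℝ)) isOpen_Ioi
    have hlim : ENNReal.ofReal α ≤
        (gaussianReal 0 σ2).map (fun ω => id ω + q * √(σ2 : ℝ)) (Set.Ioi 0) := by
      rw [Measure.map_apply (by fun_prop) measurableSet_Ioi]
      refine (ENNReal.ofReal_le_ofReal (le_cdf_normalQuantile hα)).trans ?_
      rw [ofReal_cdf]
      exact (gaussianReal_add_mul_pos hσ0 q).ge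
    refine hlim.trans (hopen.trans (liminf_le_liminf ?_))
    filter_upwards [eventually_ge_atTop 1] with N hN
    have hN' : (0 : ℝ) < N := by positivity
    have hs : 0 < √(N : ℝ) := Real.sqrt_pos.2 hN'
    change P.map _ (Set.Ioi 0) ≤ _
    rw [Measure.map_apply_of_aemeasurable (hsum.forall_aemeasurable N) measurableSet_Ioi]
    refine measure_mono fun ω hω => ?_
    simp only [Set.mem_preimage, Pi.add_apply, Set.mem_Ioi] at hω
    have hsm : ∑ n ∈ Finset.range N, W n ω = N * sampleMean (fun n => W n ω) N := by
      unfold sampleMean; field_simp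
    rw [hsm] at hω
    simp only [Set.mem_ofPred_eq]
    rw [Real.sqrt_div' _ hN'.le]
    have h2 : 0 < (√(N : ℝ))⁻¹ * ((√(N : ℝ))⁻¹ * (N * sampleMean (fun n => W n ω) N - N * P[W 0])
        + q * √(sampleVar (fun n => W n ω) N)) := by positivity
    have h3 : (√(N : ℝ))⁻¹ * (√(N : ℝ))⁻¹ * N = 1 := by
      rw [← mul_inv, Real.mul_self_sqrt hN'.le]; field_simp
    have h4 : (√(N : ℝ))⁻¹ * ((√(N : ℝ))⁻¹ * (N * sampleMean (fun n => W n ω) N - N * P[W 0])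
        + q * √(sampleVar (fun n => W n ω) N)) =
        ((√(N : ℝ))⁻¹ * (√(N : ℝ))⁻¹ * N) * (sampleMean (fun n => W n ω) N - P[W 0]) +
        q * (√(sampleVar (fun n => W n ω) N) / √(N : ℝ)) := by ring
    rw [h4, h3] at h2
    linarith

end ConfidenceBound

/-! ### The distorted measure as a reweighting of `P` -/

section ChangeOfMeasure

variable {Ω E : Type*} [MeasurableSpace Ω] [MeasurableSpace E]

/-- For fixed `A`, disintegration says that `κ · A` is the density of `P(A ∩ X ∈ ·)` with respect to
the law of `X`. -/
theorem distortedMeasure_eq_withDensity {κ : Kernel E Ω} {P : Measure Ω} [IsFiniteMeasure P]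
    {X : Ω → E} (hX : Measurable X) (hκ : IsRegularCondVersion κ P X) {ν : Measure E}
    [IsFiniteMeasure ν] (hν : ν ≪ P.map X) :
    distortedMeasure κ ν = P.withDensity fun ω => ν.rnDeriv (P.map X) (X ω) := by
  ext A hA
  have hκA : Measurable fun x => κ x A := κ.measurable_coe hA
  have hmap : (P.restrict A).map X = (P.map X).withDensity fun x => κ x A := by
    ext B hB
    rw [Measure.map_apply hX hB, Measure.restrict_apply (hX hB), hκ.disintegration A hA B hB,
      withDensity_apply _ hB]
  rw [distortedMeasure_apply κ ν hA, withDensity_apply _ hA,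
    ← lintegral_map (Measure.measurable_rnDeriv ν (P.map X)) hX, hmap,
    lintegral_withDensity_eq_lintegral_mul _ hκA (Measure.measurable_rnDeriv ν (P.map X)),
    ← lintegral_rnDeriv_mul hν hκA.aemeasurable]
  simp [mul_comm]

theorem map_withDensity_rnDeriv_comp {P : Measure Ω} [IsFiniteMeasure P]
    {X : Ω → E} (hX : Measurable X) {ν : Measure E}
    [IsFiniteMeasure ν] (hν : ν ≪ P.map X) :
    (P.withDensity fun ω => ν.rnDeriv (P.map X) (X ω)).map X = ν := by
  ext B hB
  rw [Measure.map_apply hX hB, withDensity_apply _ (hX hB),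
    ← setLIntegral_map hB (Measure.measurable_rnDeriv ν (P.map X)) hX,
    Measure.setLIntegral_rnDeriv hν]

/-- Reweighting by a conditioning-measurable density does not change conditional expectations. -/
theorem condExp_withDensity {Ω : Type*} {m m₀ : MeasurableSpace Ω} (hm : m ≤ m₀) {P : @Measure Ω m₀}
    [IsFiniteMeasure P] {ρ : Ω → ENNReal} (hρ : Measurable[m] ρ) [IsFiniteMeasure (P.withDensity ρ)]
    {Y : Ω → ℝ} (hY : Integrable Y P) (hYρ : Integrable Y (P.withDensity ρ)) :
    P[Y | m] =ᵐ[P.withDensity ρ] (P.withDensity ρ)[Y | m] := by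
  have hρ₀ : Measurable ρ := hρ.mono hm le_rfl
  have hfin : ∀ᵐ ω ∂P, ρ ω < ⊤ := by
    refine ae_lt_top hρ₀ ?_
    rw [← setLIntegral_univ, ← withDensity_apply _ MeasurableSet.univ]
    exact measure_ne_top _ _
  have hρY : Integrable ((fun ω => (ρ ω).toReal) * Y) P :=
    (integrable_withDensity_iff_integrable_smul' hρ₀ hfin).1 hYρ
  -- As `ρ` is `m`-measurable, it can be taken out of the conditional expectation.
  have hpull : P[(fun ω => (ρ ω).toReal) * Y | m] =ᵐ[P] (fun ω => (ρ ω).toReal) * P[Y | m] :=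
    condExp_mul_of_stronglyMeasurable_left hρ.ennreal_toReal.stronglyMeasurable hρY hY
  have hint : Integrable (P[Y | m]) (P.withDensity ρ) :=
    (integrable_withDensity_iff_integrable_smul' hρ₀ hfin).2 (integrable_condExp.congr hpull)
  refine ae_eq_condExp_of_forall_setIntegral_eq hm hYρ (fun s _ _ => hint.integrableOn)
    (fun s hs _ => ?_) stronglyMeasurable_condExp.aestronglyMeasurable
  rw [setIntegral_withDensity_eq_setIntegral_toReal_smul hρ₀ (ae_restrict_of_ae hfin) _ (hm s hs),
    setIntegral_withDensity_eq_setIntegral_toReal_smul hρ₀ (ae_restrict_of_ae hfin) _ (hm s hs)]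
  have := setIntegral_condExp hm hρY hs
  rw [setIntegral_congr_ae (hm s hs) (hpull.mono fun ω h _ => h)] at this
  simpa using this

/-- The regression function under `P` is also a regression function under `P^ν`. -/
theorem IsRegressionFunction.distortedMeasure {κ : Kernel E Ω} {P : Measure Ω} [IsFiniteMeasure P]
    {X : Ω → E} (hX : Measurable X) (hκ : IsRegularCondVersion κ P X) {ν : Measure E}
    [IsFiniteMeasure ν] (hν : ν ≪ P.map X) {f : E → ℝ} {Y : Ω → ℝ}
    (hf : IsRegressionFunction f P X Y) (hY : Integrable Y P)
    (hYν : Integrable Y (distortedMeasure κ ν)) :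
    IsRegressionFunction f (distortedMeasure κ ν) X Y := by
  refine ⟨hf.1, ?_⟩
  have hmap := map_withDensity_rnDeriv_comp hX hν
  rw [distortedMeasure_eq_withDensity hX hκ hν] at hYν ⊢
  have : IsFiniteMeasure (P.withDensity fun ω => ν.rnDeriv (P.map X) (X ω)) := by
    constructor
    rw [← Set.preimage_univ (f := X), ← Measure.map_apply hX MeasurableSet.univ, hmap]
    exact measure_lt_top _ _
  refine ((withDensity_absolutelyContinuous _ _).ae_eq hf.2).trans ?_
  exact condExp_withDensity (ρ := fun ω => ν.rnDeriv (P.map X) (X ω)) hX.comap_le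
    ((Measure.measurable_rnDeriv ν (P.map X)).comp (comap_measurable X)) hY hYν

theorem map_distortedMeasure {κ : Kernel E Ω} {P : Measure Ω} [IsFiniteMeasure P]
    {X : Ω → E} (hX : Measurable X) (hκ : IsRegularCondVersion κ P X) {ν : Measure E}
    [IsFiniteMeasure ν] (hν : ν ≪ P.map X) : (distortedMeasure κ ν).map X = ν := by
  rw [distortedMeasure_eq_withDensity hX hκ hν, map_withDensity_rnDeriv_comp hX hν]

end ChangeOfMeasure

/-! ### Mean and integrability of the error term -/

section Regression

variable {Ω E G : Type*} [MeasurableSpace Ω] [mE : MeasurableSpace E] [MeasurableSpace G]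
  {Q : Measure Ω} {X : Ω → E} {Y : Ω → ℝ} {f : E → ℝ}

theorem IsRegressionFunction.memLp (hf : IsRegressionFunction f Q X Y) (hY : MemLp Y 2 Q) :
    MemLp (fun ω => f (X ω)) 2 Q :=
  (memLp_congr_ae hf.2).2 (hY.condExp one_le_two)

theorem IsRegressionFunction.integral_mul [IsProbabilityMeasure Q] (hX : Measurable X) (hf : IsRegressionFunction f Q X Y)
    (hY : MemLp Y 2 Q) {g : E → ℝ} (hg : Measurable g) (hg2 : MemLp (fun ω => g (X ω)) 2 Q) :
    ∫ ω, g (X ω) * Y ω ∂Q = ∫ ω, g (X ω) * f (X ω) ∂Q := by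
  have hpull := condExp_mul_of_stronglyMeasurable_left (m := mE.comap X) (μ := Q)
    (f := fun ω => g (X ω)) (g := Y) (hg.comp (comap_measurable X)).stronglyMeasurable
    (hg2.integrable_mul hY) (hY.integrable one_le_two)
  calc ∫ ω, g (X ω) * Y ω ∂Q = ∫ ω, (Q[(fun ω => g (X ω)) * Y | mE.comap X]) ω ∂Q :=
        (integral_condExp hX.comap_le).symm
    _ = ∫ ω, g (X ω) * f (X ω) ∂Q := by
        refine integral_congr_ae ?_
        filter_upwards [hpull, hf.2] with ω h1 h2
        rw [h1, Pi.mul_apply, h2]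

/-- If `Y = h(X, V)` with `V` independent of `X`, then `x ↦ E[h(x, V)]` is the regression
function. -/
theorem IsRegressionFunction.ae_eq_integral [IsProbabilityMeasure Q] (hX : Measurable X)
    (hf : IsRegressionFunction f Q X Y) (hY : Integrable Y Q) {V : Ω → G} (hV : Measurable V)
    {h : E × G → ℝ} (hh : Measurable h) (hR : Y =ᵐ[Q] fun ω => h (X ω, V ω))
    (hXV : IndepFun X V Q) :
    (fun x => ∫ v, h (x, v) ∂(Q.map V)) =ᵐ[Q.map X] f := by
  have := Measure.isProbabilityMeasure_map (μ := Q) hX.aemeasurable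
  have := Measure.isProbabilityMeasure_map (μ := Q) hV.aemeasurable
  have hprod := (indepFun_iff_map_prod_eq_prod_map_map hX.aemeasurable hV.aemeasurable).1 hXV
  have hint : Integrable h ((Q.map X).prod (Q.map V)) := by
    rw [← hprod]
    exact (integrable_map_measure hh.aestronglyMeasurable (by fun_prop)).2 (hY.congr hR)
  refine Integrable.ae_eq_of_forall_setIntegral_eq _ _ hint.integral_prod_left
    ((integrable_map_measure hf.1.aestronglyMeasurable hX.aemeasurable).2
      (integrable_condExp.congr hf.2.symm)) fun B hB _ => ?_
  rw [setIntegral_map hB hf.1.aestronglyMeasurable hX.aemeasurable,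
    setIntegral_congr_ae (hX hB) (hf.2.mono fun ω h _ => h),
    setIntegral_condExp hX.comap_le hY ⟨B, hB, rfl⟩,
    setIntegral_congr_ae (hX hB) (hR.mono fun ω h _ => h)]
  have h1 := setIntegral_prod (s := B) (t := Set.univ) h hint.integrableOn
  simp only [Measure.restrict_univ] at h1
  rw [← h1, ← hprod, setIntegral_map (hB.prod MeasurableSet.univ) hh.aestronglyMeasurable
    (by fun_prop)]
  congr 2
  ext ω
  simp

/-- The law of the error term under the sampling law has mean the squared `L²`-error, and it is
square integrable. -/
theorem errorTerm_memLp_and_integral [IsProbabilityMeasure Q] (hX : Measurable X) (hYm : Measurable Y)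
    (hf : IsRegressionFunction f Q X Y)
    (hY4 : MemLp Y 4 Q) {V : Ω → G} (hV : Measurable V)
    {h : E × G → ℝ} (hh : Measurable h) (hR : Y =ᵐ[Q] fun ω => h (X ω, V ω))
    (hXV : IndepFun X V Q) {g : E → ℝ} (hg : Measurable g)
    (hg4 : MemLp (fun ω => g (X ω)) 4 Q) :
    MemLp (fun p : (E × ℝ) × G => errorTerm g h p.1.1 p.1.2 p.2) 2
      ((Q.map fun ω => (X ω, Y ω)).prod (Q.map V)) ∧
    ∫ p, errorTerm g h p.1.1 p.1.2 p.2 ∂((Q.map fun ω => (X ω, Y ω)).prod (Q.map V)) =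
      sqL2Error (Q.map X) g f := by
  have hXY : Measurable fun ω => (X ω, Y ω) := by fun_prop
  have := Measure.isProbabilityMeasure_map (μ := Q) hX.aemeasurable
  have := Measure.isProbabilityMeasure_map (μ := Q) hV.aemeasurable
  have := Measure.isProbabilityMeasure_map (μ := Q) hXY.aemeasurable
  have hY2 : MemLp Y 2 Q := hY4.mono_exponent (by norm_num)
  have hg2 : MemLp (fun ω => g (X ω)) 2 Q := hg4.mono_exponent (by norm_num)
  have hf2 := hf.memLp hY2
  have hHT : ENNReal.HolderTriple 4 4 2 := by
    constructor
    rw [show (4 : ENNReal) = 2 * 2 by norm_num, ENNReal.mul_inv (by simp) (by simp), ← mul_add,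
      ENNReal.inv_two_add_inv_two, mul_one]
  set μXY := Q.map fun ω => (X ω, Y ω) with hμXY
  have hfst : μXY.map Prod.fst = Q.map X := by
    rw [hμXY, Measure.map_map measurable_fst hXY]; rfl
  have hprod := (indepFun_iff_map_prod_eq_prod_map_map hX.aemeasurable hV.aemeasurable).1 hXV
  have hA : MemLp (fun p : E × ℝ => p.2 - g p.1) 4 μXY :=
    (memLp_map_measure_iff (by fun_prop) hXY.aemeasurable).2 (hY4.sub hg4)
  have hB : MemLp (fun p : E × G => h p - g p.1) 4 ((Q.map X).prod (Q.map V)) := by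
    rw [← hprod]
    refine (memLp_map_measure_iff (by fun_prop) (by fun_prop)).2 ?_
    exact ((memLp_congr_ae hR).1 hY4).sub hg4
  have hA' : MemLp (fun p : (E × ℝ) × G => p.1.2 - g p.1.1) 4 (μXY.prod (Q.map V)) :=
    hA.comp_fst _
  -- `X` with the fresh copy of `V` has the same law as `(X, V)`, so `Z - g(X)` inherits the fourth
  -- moment of `Y - g(X)`.
  have hB' : MemLp (fun p : (E × ℝ) × G => h (p.1.1, p.2) - g p.1.1) 4 (μXY.prod (Q.map V)) := by
    have hmp : (μXY.prod (Q.map V)).map (Prod.map Prod.fst id) = (Q.map X).prod (Q.map V) := by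
      rw [← Measure.map_prod_map _ _ measurable_fst measurable_id, hfst, Measure.map_id]
    rw [← hmp] at hB
    exact (memLp_map_measure_iff (by fun_prop) (by fun_prop)).1 hB
  have heq : (fun p : (E × ℝ) × G => errorTerm g h p.1.1 p.1.2 p.2) =
      (fun p : (E × ℝ) × G => (p.1.2 - g p.1.1) * (h (p.1.1, p.2) - g p.1.1)) := by
    ext p; unfold errorTerm; ring
  have hW : MemLp (fun p : (E × ℝ) × G => errorTerm g h p.1.1 p.1.2 p.2) 2
      (μXY.prod (Q.map V)) := by
    rw [heq]
    exact hB'.mul hA'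
  refine ⟨hW, ?_⟩
  have hcond := hf.ae_eq_integral hX (hY2.integrable one_le_two) hV hh hR hXV
  have hint : Integrable h ((Q.map X).prod (Q.map V)) := by
    rw [← hprod]
    exact (integrable_map_measure hh.aestronglyMeasurable (by fun_prop)).2
      ((hY2.integrable one_le_two).congr hR)
  have hinner : ∀ᵐ x ∂(Q.map X), ∫ v, (h (x, v) - g x) ∂(Q.map V) = f x - g x := by
    filter_upwards [hcond, hint.prod_right_ae] with x h1 h2
    rw [integral_sub h2 (integrable_const _), h1]
    simp
  rw [integral_prod _ (hW.integrable one_le_two), hμXY,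
    integral_map hXY.aemeasurable (hW.integrable one_le_two).integral_prod_left.aestronglyMeasurable]
  -- Integrating out the fresh `v` turns the second factor into `f(X) - g(X)`, a function of `X`;
  -- hence `Y` in the first factor may be replaced by `f(X)`.
  have hstep : ∫ ω, ∫ v, errorTerm g h (X ω) (Y ω) v ∂(Q.map V) ∂Q =
      ∫ ω, (f (X ω) - g (X ω)) * Y ω - (f (X ω) - g (X ω)) * g (X ω) ∂Q := by
    refine integral_congr_ae ?_
    filter_upwards [ae_of_ae_map hX.aemeasurable hinner] with ω hω
    have : ∀ v, errorTerm g h (X ω) (Y ω) v = (Y ω - g (X ω)) * (h (X ω, v) - g (X ω)) :=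
      fun v => by unfold errorTerm; ring
    simp_rw [this, integral_const_mul, hω]
    ring
  have hfg : MemLp (fun ω => f (X ω) - g (X ω)) 2 Q := hf2.sub hg2
  have hsub {U : Ω → ℝ} (hU : MemLp U 2 Q) :
      ∫ ω, (f (X ω) - g (X ω)) * U ω - (f (X ω) - g (X ω)) * g (X ω) ∂Q =
        ∫ ω, (f (X ω) - g (X ω)) * U ω ∂Q - ∫ ω, (f (X ω) - g (X ω)) * g (X ω) ∂Q :=
    integral_sub (hfg.integrable_mul hU) (hfg.integrable_mul hg2)
  have hfm := hf.1
  rw [hstep, hsub hY2, hf.integral_mul hX hY2 (g := fun x => f x - g x) (hf.1.sub hg) hfg,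
    ← hsub hf2, sqL2Error,
    integral_map hX.aemeasurable (by fun_prop)]
  congr 1
  ext ω
  ring

end Regression

/-! ### Application to the simulated data -/

theorem memLp_four_of_integrable_pow {Ω : Type*} [MeasurableSpace Ω] {P : Measure Ω} {Y : Ω → ℝ}
    (hY : AEStronglyMeasurable Y P) (h : Integrable (fun ω => Y ω ^ 4) P) : MemLp Y 4 P := by
  rw [← integrable_norm_rpow_iff hY (by norm_num) (by norm_num)]
  refine h.congr (.of_forall fun ω => ?_)
  norm_num [Real.norm_eq_abs]
  exact ((show Even 4 by decide).pow_abs _).symm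

end RegressionError

theorem mainTheorem3 {Ω Ω' : Type*} [MeasurableSpace Ω] [MeasurableSpace Ω'] {d k : ℕ}
    -- the original probability space, the random vector `X` and the square-integrable `Y`
    (P : Measure Ω) [IsProbabilityMeasure P]
    (X : Ω → EuclideanSpace ℝ (Fin d)) (hX : Measurable X)
    (Y : Ω → ℝ) (hY : Measurable Y) (hY2 : MemLp Y 2 P)
    -- a regular conditional version of `P` given `X`, and the distorted measure `P^ν`
    (κ : Kernel (EuclideanSpace ℝ (Fin d)) Ω)
    (hκ : RegressionError.IsRegularCondVersion κ P X)
    (ν : Measure (EuclideanSpace ℝ (Fin d))) [IsProbabilityMeasure ν] (hν : ν ≪ P.map X)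
    (Pν : Measure Ω) (hPν : Pν = RegressionError.distortedMeasure κ ν)
    -- the true regression function and the candidate regression function
    (fbar : EuclideanSpace ℝ (Fin d) → ℝ)
    (hfbar : RegressionError.IsRegressionFunction fbar P X Y)
    (fhat : EuclideanSpace ℝ (Fin d) → ℝ) (hfhat : Measurable fhat)
    -- the representation `Y = h(X, V)` with `V` independent of `X` under `P^ν`
    (h : EuclideanSpace ℝ (Fin d) × EuclideanSpace ℝ (Fin k) → ℝ) (hh : Measurable h)
    (V : Ω → EuclideanSpace ℝ (Fin k)) (hV : Measurable V)
    (hR : Y =ᵐ[Pν] fun ω => h (X ω, V ω)) (hXV : IndepFun X V Pν)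
    -- the moment assumptions
    (hY4 : Integrable (fun ω => Y ω ^ 4) Pν)
    (hf4 : Integrable (fun ω => fhat (X ω) ^ 4) Pν)
    -- the simulated data
    (P' : Measure Ω') [IsProbabilityMeasure P']
    (Xs : ℕ → Ω' → EuclideanSpace ℝ (Fin d)) (Ys : ℕ → Ω' → ℝ)
    (Vs : ℕ → Ω' → EuclideanSpace ℝ (Fin k))
    (hs : RegressionError.IsMonteCarloSample P' (Pν.map fun ω => (X ω, Y ω)) (Pν.map V) Xs Ys Vs)
    (W : Ω' → ℕ → ℝ)
    (hW : W = fun ω n => RegressionError.errorTerm fhat h (Xs n ω) (Ys n ω) (Vs n ω)) :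
    MemLp (fun x => fhat x - fbar x) 2 ν ∧
    ∀ α ∈ Set.Ioo (0 : ℝ) 1,
      ENNReal.ofReal α ≤
        liminf (fun N : ℕ =>
          P' {ω | RegressionError.sqL2Error ν fhat fbar ≤
            RegressionError.sampleMean (W ω) N +
              RegressionError.normalQuantile α *
                √(RegressionError.sampleVar (W ω) N / (N : ℝ))}) atTop := by
  subst hPν hW
  have hνX := RegressionError.map_distortedMeasure hX hκ hν
  set Pν := RegressionError.distortedMeasure κ ν
  have hprob : IsProbabilityMeasure Pν := by
    constructor
    rw [← Set.preimage_univ (f := X), ← Measure.map_apply hX MeasurableSet.univ, hνX]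
    exact measure_univ
  have hY4' := RegressionError.memLp_four_of_integrable_pow hY.aestronglyMeasurable hY4
  have hf4' := RegressionError.memLp_four_of_integrable_pow
    (hfhat.comp hX).aestronglyMeasurable hf4
  have hreg : RegressionError.IsRegressionFunction fbar Pν X Y :=
    hfbar.distortedMeasure hX hκ hν (hY2.integrable one_le_two)
      (hY4'.integrable (by norm_num))
  have hlaw n : P'.map (fun ω => ((Xs n ω, Ys n ω), Vs n ω)) =
      (Pν.map fun ω => (X ω, Y ω)).prod (Pν.map V) := by
    rw [← hs.law_XY n, ← hs.law_V' n]
    exact (indepFun_iff_map_prod_eq_prod_map_map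
      ((hs.measurable_X n).prodMk (hs.measurable_Y n)).aemeasurable
      (hs.measurable_V' n).aemeasurable).1 (hs.indep_V' n)
  have hmeas n : Measurable fun ω => ((Xs n ω, Ys n ω), Vs n ω) :=
    ((hs.measurable_X n).prodMk (hs.measurable_Y n)).prodMk (hs.measurable_V' n)
  have hterm : Measurable fun p : (EuclideanSpace ℝ (Fin d) × ℝ) × EuclideanSpace ℝ (Fin k) =>
      RegressionError.errorTerm fhat h p.1.1 p.1.2 p.2 := by
    unfold RegressionError.errorTerm; fun_prop
  obtain ⟨hL2, hmean⟩ :=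
    RegressionError.errorTerm_memLp_and_integral hX hY hreg hY4' hV hh hR hXV hfhat hf4'
  refine ⟨?_, fun α hα => ?_⟩
  · rw [← hνX]
    exact (memLp_map_measure_iff (hfhat.sub hfbar.1).aestronglyMeasurable hX.aemeasurable).2
      ((hf4'.mono_exponent (by norm_num)).sub
        (hreg.memLp (hY4'.mono_exponent (by norm_num))))
  · have hconf := RegressionError.le_liminf_measure_mean_le (P := P')
      (W := fun n ω => RegressionError.errorTerm fhat h (Xs n ω) (Ys n ω) (Vs n ω))
      ?_ ?_ ?_ hα
    · have hE : ∫ ω, RegressionError.errorTerm fhat h (Xs 0 ω) (Ys 0 ω) (Vs 0 ω) ∂P' =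
          RegressionError.sqL2Error ν fhat fbar := by
        rw [hνX, ← hlaw 0, integral_map (hmeas 0).aemeasurable hterm.aestronglyMeasurable] at hmean
        exact hmean
      rwa [hE] at hconf
    · rw [← hlaw 0] at hL2
      exact (memLp_map_measure_iff hterm.aestronglyMeasurable (hmeas 0).aemeasurable).1 hL2
    · exact hs.indep.comp
        (fun _ p => RegressionError.errorTerm fhat h p.1 p.2.1 p.2.2)
        (fun _ => by unfold RegressionError.errorTerm; fun_prop)
    · intro n
      have hid : IdentDistrib (fun ω => ((Xs n ω, Ys n ω), Vs n ω))
          (fun ω => ((Xs 0 ω, Ys 0 ω), Vs 0 ω)) P' P' :=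
        ⟨(hmeas n).aemeasurable, (hmeas 0).aemeasurable, (hlaw n).trans (hlaw 0).symm⟩
      exact hid.comp hterm
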